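/- **Theorem (0-1 law).** Let $\mu_4$ be the middle-fourth Cantor measure, i.e. the Borel probability measure on $\mathbb R$ with $\mu_4=\tfrac12\,\mu_4\circ\tau_1^{-1}+\tfrac12\,\mu_4\circ\tau_2^{-1}$, where $\tau_1(x)=x/4$ and $\tau_2(x)=(x+2)/4$. A set $\Lambda\subset\mathbb R$ is a spectrum for $\mu_4$ if $\{e^{2\pi i\lambda x}:\lambda\in\Lambda\}$ is an orthonormal basis of $L^2(\mu_4)$. Let $C=\{c_0,\dots,c_{m-1}\}$ be a finite set of $m$ integers whose set of residues modulo $4$ is exactly $\{1,3\}$ (so $m\ge 2$ and all $c_j$ are odd). Write an infinite word $L\in C^\infty$ as $$L=a_{1,1}\,a_{2,1}a_{2,3}\,a_{3,1}a_{3,3}a_{3,5}a_{3,7}\cdots,$$ with $2^{n-1}$ entries $a_{n,k}$ ($1\le k\le 2^n-1$ odd) at level $n\ge1$, put $a_{n,k}=0$ for even $k$ with $0\le k\le 2^n-2$, and let $$\Lambda(L)=\Big\{\sum_{i=1}^n 4^{i-1}a_{i,k_i}:\ n\ge1,\ k_1\in\{0,1\},\ k_{i+1}\in\{2k_i,2k_i+1\}\text{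 for all } i\ge1\Big\}.$$ Let $\mathcal N(C)$ be the set of all $L\in C^\infty$ for which $\Lambda(L)$ is not a spectrum for $\mu_4$. Then $\mathcal N(C)$ is either empty, or it is an infinite set of full Hausdorff dimension: for every $r\in(0,1)$ it has the same Hausdorff dimension as the whole space $C^\infty$ with respect to the metric in which two distinct words have distance $r^n$, where $n$ is the length of their longest common prefix; and for $r=1/m$ this dimension equals $1$. Moreover, $\mathcal N(\{1,7\})=\emptyset$. -/

import Mathlib

open MeasureTheory

noncomputable section

namespace MiddleFourth

/-! ### The middle-fourth Cantor measure -/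

/-- A fair coin on `{0, 1}`. -/
def coin : Measure (Fin 2) :=
  (2⁻¹ : ENNReal) • Measure.dirac 0 + (2⁻¹ : ENNReal) • Measure.dirac 1

instance isProbabilityMeasure_coin : IsProbabilityMeasure coin :=
  ⟨by simp [coin, ENNReal.inv_two_add_inv_two]⟩

/-- Infinitely many independent fair coins. -/
def coins : Measure (ℕ → Fin 2) := Measure.infinitePi fun _ => coin

instance isProbabilityMeasure_coins : IsProbabilityMeasure coins := by
  unfold coins; infer_instance

/-- The point of the middle-fourth Cantor set whose `(k+1)`-st base `4` digit is `2 * ε k`. -/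
def cantorPoint (ε : ℕ → Fin 2) : ℝ := ∑' k : ℕ, 2 * ((ε k : ℕ) : ℝ) / 4 ^ (k + 1)

/-- The middle-fourth Cantor measure `μ₄`: the law of the random series `∑ 2 ε_k / 4^(k+1)` with
independent fair coins `ε_k ∈ {0, 1}`. By `muFour_invariant` below, it is the Borel probability
measure that is invariant under the system `x ↦ x / 4`, `x ↦ (x + 2) / 4` with weights `1 / 2`. -/
def muFour : Measure ℝ := coins.map cantorPoint

theorem summable_cantorPoint (ε : ℕ → Fin 2) :
    Summable fun k : ℕ => 2 * ((ε k : ℕ) : ℝ) / 4 ^ (k + 1) := by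
  refine Summable.of_nonneg_of_le (fun k => by positivity) (fun k => ?_)
    (summable_geometric_of_lt_one (r := (1 / 4 : ℝ)) (by norm_num) (by norm_num))
  have h : ((ε k : ℕ) : ℝ) ≤ 1 := by
    have := (ε k).isLt
    exact_mod_cast (by omega : (ε k : ℕ) ≤ 1)
  rw [div_pow, one_pow, div_le_div_iff₀ (by positivity) (by positivity), pow_succ]
  nlinarith [pow_pos (by norm_num : (0 : ℝ) < 4) k]

theorem measurable_cantorPoint : Measurable cantorPoint := by
  refine measurable_of_tendsto_metrizable
    (f := fun (n : ℕ) (ε : ℕ → Fin 2) =>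
      ∑ k ∈ Finset.range n, 2 * ((ε k : ℕ) : ℝ) / 4 ^ (k + 1)) (fun n => ?_) ?_
  · refine Finset.measurable_sum _ fun k _ => ?_
    have h : Measurable fun i : Fin 2 => 2 * ((i : ℕ) : ℝ) / 4 ^ (k + 1) := measurable_of_finite _
    exact h.comp (measurable_pi_apply k)
  · rw [tendsto_pi_nhds]
    exact fun ε => (summable_cantorPoint ε).hasSum.tendsto_sum_nat

instance isProbabilityMeasure_muFour : IsProbabilityMeasure muFour :=
  Measure.isProbabilityMeasure_map measurable_cantorPoint.aemeasurable

/-- Prepend a coin to a sequence of coins. -/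
def consCoin (d : Fin 2) (ε : ℕ → Fin 2) : ℕ → Fin 2 := fun n => Nat.casesOn n d ε

theorem measurable_consCoin (d : Fin 2) : Measurable (consCoin d) := by
  refine measurable_pi_lambda _ fun n => ?_
  cases n with
  | zero => exact measurable_const
  | succ n => exact measurable_pi_apply n

theorem cantorPoint_consCoin (d : Fin 2) (ε : ℕ → Fin 2) :
    cantorPoint (consCoin d ε) = (cantorPoint ε + 2 * ((d : ℕ) : ℝ)) / 4 := by
  unfold cantorPoint
  rw [(summable_cantorPoint (consCoin d ε)).tsum_eq_zero_add]
  have h : ∀ k : ℕ, 2 * ((consCoin d ε (k + 1) : ℕ) : ℝ) / 4 ^ (k + 1 + 1)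
      = 2 * ((ε k : ℕ) : ℝ) / 4 ^ (k + 1) / 4 := fun k => by
    rw [pow_succ _ (k + 1), ← div_div]; rfl
  have h0 : consCoin d ε 0 = d := rfl
  rw [tsum_congr h, tsum_div_const, h0]
  ring

theorem coins_eq : coins =
    (2⁻¹ : ENNReal) • coins.map (consCoin 0) + (2⁻¹ : ENNReal) • coins.map (consCoin 1) := by
  symm
  refine Measure.eq_infinitePi _ fun s t ht => ?_
  have key : ∀ d : Fin 2, coins.map (consCoin d) (Set.pi s t)
      = (if 0 ∈ s then (t 0).indicator 1 d else 1) *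
        ∏ i ∈ s.erase 0, coin (t i) := by
    intro d
    rw [Measure.map_apply (measurable_consCoin d)
      (MeasurableSet.pi s.countable_toSet fun i _ => ht i)]
    have hpre : consCoin d ⁻¹' (Set.pi s t) =
        {ε | (0 ∈ s → d ∈ t 0)} ∩
          Set.pi ((s.erase 0).image Nat.pred) (fun i => t (i + 1)) := by
      ext ε
      simp only [Set.mem_preimage, Set.mem_pi, Finset.mem_coe, Set.mem_inter_iff,
        Set.mem_ofPred_eq, Finset.mem_image, Finset.mem_erase]
      constructor
      · intro h
        refine ⟨fun h0 => h 0 h0, ?_⟩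
        rintro i ⟨j, ⟨hj0, hj⟩, rfl⟩
        obtain ⟨j, rfl⟩ := Nat.exists_eq_succ_of_ne_zero hj0
        exact h (j + 1) hj
      · rintro ⟨h0, h⟩ i hi
        cases i with
        | zero => exact h0 hi
        | succ i => exact h i ⟨i + 1, ⟨by omega, hi⟩, rfl⟩
    have hprod : coins (Set.pi ((s.erase 0).image Nat.pred) (fun i => t (i + 1))) =
        ∏ i ∈ s.erase 0, coin (t i) := by
      unfold coins
      rw [Measure.infinitePi_pi _ (fun i _ => ht (i + 1)), Finset.prod_image]
      · refine Finset.prod_congr rfl fun i hi => ?_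
        rw [Nat.pred_eq_sub_one, Nat.sub_add_cancel
          (Nat.one_le_iff_ne_zero.2 (Finset.mem_erase.1 hi).1)]
      · intro a ha b hb hab
        have := (Finset.mem_erase.1 (Finset.mem_coe.1 ha)).1
        have := (Finset.mem_erase.1 (Finset.mem_coe.1 hb)).1
        simp only [Nat.pred_eq_sub_one] at hab
        omega
    rw [hpre, ← hprod]
    by_cases h0 : 0 ∈ s
    · by_cases hd : d ∈ t 0
      · simp [h0, hd]
      · simp [h0, hd]
    · simp [h0]
  rw [Measure.add_apply, Measure.smul_apply, Measure.smul_apply, key, key, smul_eq_mul,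
    smul_eq_mul]
  by_cases h0 : 0 ∈ s
  · rw [← Finset.mul_prod_erase s _ h0]
    simp only [h0, if_true]
    simp only [coin, Measure.add_apply, Measure.smul_apply, smul_eq_mul,
      Measure.dirac_apply' _ (ht 0)]
    ring
  · simp only [h0, if_false, one_mul, Finset.erase_eq_of_notMem h0]
    rw [← add_mul, ENNReal.inv_two_add_inv_two, one_mul]

/-- The invariance equation of the middle-fourth Cantor measure. -/
theorem muFour_invariant : muFour =
    (2⁻¹ : ENNReal) • muFour.map (fun x : ℝ => x / 4) +
      (2⁻¹ : ENNReal) • muFour.map (fun x : ℝ => (x + 2) / 4) := by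
  have hm : ∀ d : Fin 2, (coins.map (consCoin d)).map cantorPoint =
      muFour.map (fun x : ℝ => (x + 2 * ((d : ℕ) : ℝ)) / 4) := fun d => by
    have hτ : Measurable fun x : ℝ => (x + 2 * ((d : ℕ) : ℝ)) / 4 := by fun_prop
    unfold muFour
    rw [Measure.map_map measurable_cantorPoint (measurable_consCoin d),
      Measure.map_map hτ measurable_cantorPoint]
    congr 1
    funext ε
    exact cantorPoint_consCoin d ε
  have h0 := hm 0
  have h1 := hm 1
  simp only [Fin.val_zero, Fin.val_one, Nat.cast_zero, Nat.cast_one, mul_zero, add_zero,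
    mul_one] at h0 h1
  conv_lhs => rw [muFour, coins_eq]
  rw [Measure.map_add _ _ measurable_cantorPoint, Measure.map_smul, Measure.map_smul, h0, h1]

/-! ### Spectra of a measure on the line -/

/-- The exponential `e_ξ(x) = exp(2πiξx)`. -/
def expFun (ξ : ℝ) (x : ℝ) : ℂ := Complex.exp (2 * Real.pi * Complex.I * ξ * x)

theorem memLp_expFun (μ : Measure ℝ) [IsFiniteMeasure μ] (ξ : ℝ) : MemLp (expFun ξ) 2 μ := by
  refine MemLp.of_bound (C := 1) ?_ (Filter.Eventually.of_forall fun x => ?_)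
  · refine Continuous.aestronglyMeasurable ?_
    unfold expFun
    fun_prop
  · have h : (2 * Real.pi * Complex.I * ξ * x : ℂ)
        = ((2 * Real.pi * ξ * x : ℝ) : ℂ) * Complex.I := by push_cast; ring
    rw [expFun, h, Complex.norm_exp_ofReal_mul_I]

/-- The exponential `e_ξ` as an element of `L²(μ)`. -/
def expLp (μ : Measure ℝ) [IsFiniteMeasure μ] (ξ : ℝ) : Lp ℂ 2 μ := (memLp_expFun μ ξ).toLp

/-- `Λ` is a spectrum of `μ`: the exponentials `e_ξ`, `ξ ∈ Λ`, form an orthonormal basis of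
`L²(μ)`, that is, they are orthonormal and their linear span is dense. -/
def IsSpectrum (μ : Measure ℝ) [IsFiniteMeasure μ] (Λ : Set ℝ) : Prop :=
  Orthonormal ℂ (fun ξ : Λ => expLp μ (ξ : ℝ)) ∧
    (Submodule.span ℂ (Set.range fun ξ : Λ => expLp μ (ξ : ℝ))).topologicalClosure = ⊤

/-! ### Labelled binary trees -/

/-- The label `a_{n,k}` of the `k`-th edge, `0 ≤ k ≤ 2^n - 1`, of level `n ≥ 1` of the binary tree
labelled by `L`: left edges (`k` even) carry `0`, and the right edges (`k` odd) of the levels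
`1, 2, 3, …` carry the successive entries `L 0, L 1, L 2, …` of `L`, read from the top to the
bottom and from the left to the right in each level. The levels before level `n` have
`2^(n-1) - 1` right edges. -/
def edgeLabel (L : ℕ → ℤ) (n k : ℕ) : ℤ :=
  if Even k then 0 else L (2 ^ (n - 1) - 1 + (k - 1) / 2)

/-- `k` is an infinite path from the root: `k n`, for `n ≥ 1`, is the number of its edge of
level `n`; the dummy value `k 0 = 0` stands for the root. -/
def IsTreePath (k : ℕ → ℕ) : Prop :=
  k 0 = 0 ∧ ∀ n, k (n + 1) = 2 * k n ∨ k (n + 1) = 2 * k n + 1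

/-- The set `Λ(L)` of all finite sums `∑_{i=1}^n 4^(i-1) a_{i,k_i}` along paths of the tree. -/
def treeSet (L : ℕ → ℤ) : Set ℝ :=
  {x | ∃ k : ℕ → ℕ, IsTreePath k ∧ ∃ n : ℕ, 1 ≤ n ∧
    x = ((∑ i ∈ Finset.Icc 1 n, 4 ^ (i - 1) * edgeLabel L i (k i) : ℤ) : ℝ)}

/-- The set `N(C)` of the labels `L ∈ C^∞` for which `Λ(L)` is not a spectrum of `μ₄`. -/
def nonSpectral (C : Finset ℤ) : Set (ℕ → C) :=
  {L | ¬ IsSpectrum muFour (treeSet fun n => (L n : ℤ))}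

/-! ### Hausdorff dimension in a symbolic space -/

open Classical in
/-- The metric on infinite words over `A` for which two distinct words have distance `r ^ n`,
where `n` is the length of their longest common prefix. -/
@[reducible] def wordMetric (A : Type*) (r : ℝ) (h0 : 0 < r) (h1 : r < 1) :
    MetricSpace (ℕ → A) where
  dist x y := if x = y then 0 else r ^ PiNat.firstDiff x y
  dist_self x := by simp
  dist_comm x y := by simp [eq_comm, PiNat.firstDiff_comm]
  dist_triangle x y z := by
    rcases eq_or_ne x z with rfl | hxz
    · have : 0 ≤ if x = y then (0 : ℝ) else r ^ PiNat.firstDiff x y := by split_ifs <;> positivity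
      have : 0 ≤ if y = x then (0 : ℝ) else r ^ PiNat.firstDiff y x := by split_ifs <;> positivity
      simp only [if_true]
      linarith
    rcases eq_or_ne x y with rfl | hxy
    · simp
    rcases eq_or_ne y z with rfl | hyz
    · simp
    simp only [hxz, hxy, hyz, if_false]
    have ha := pow_pos h0 (PiNat.firstDiff x y)
    have hb := pow_pos h0 (PiNat.firstDiff y z)
    rcases min_le_iff.1 (PiNat.min_firstDiff_le x y z hxz) with h | h
    · linarith [pow_le_pow_of_le_one h0.le h1.le h]
    · linarith [pow_le_pow_of_le_one h0.le h1.le h]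
  eq_of_dist_eq_zero {x y} h := by
    by_contra hxy
    simp only [hxy, if_false] at h
    exact (pow_pos h0 _).ne' h

/-- The Hausdorff dimension of a set of infinite words for the metric `wordMetric A r`. -/
def wordDimH {A : Type*} (r : ℝ) (h0 : 0 < r) (h1 : r < 1) (S : Set (ℕ → A)) : ENNReal :=
  letI := wordMetric A r h0 h1
  dimH S

end MiddleFourth

end

/-! Write h_L(ξ) for the sum of |μ̂₄(ξ + λ)|² over λ ∈ Λ(L) (`totalPower`). The exponentials of Λ(L)
are orthonormal because all labels are odd, so h_L ≤ 1, and Λ(L) is a spectrum once h_L is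
identically 1. Splitting the tree at its root expresses h_L(ξ) as an average of h at (left subtree,
ξ/4) and (right subtree, (ξ + L 0)/4) with weights that add up to 1 (`totalPower_eq`).

Suppose that the minimum of h over all labellings and all |x| ≤ M is some q < 1. It passes to every
branch of positive weight. Going left forever would lead to x/4^n → 0, where h is close to 1; hence
a left weight vanishes at some point, which forces x to be a nonzero integer. The integers that
carry the minimum then form an invariant set of integers (`HasInvariantSet`). Without such a set,
N(C) is empty (`totalPower_eq_one`); this settles {1, 7}.

Conversely, an invariant set contains an infinite orbit z. Turning right exactly at the odd z_n
gives one path in the tree. If the labels along it follow the orbit, then μ̂₄ vanishes on z_0 +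
Λ(L), so Λ(L) is not a spectrum (`cantorPower_orbit_add_eq_zero`). Only one label per level is
prescribed, that is, about log₂ n of the first n letters, and this does not lower the Hausdorff
dimension (`wordDimH_univ_le_of_sparse`). -/

namespace MiddleFourth

/-! ### Subtrees and path sums -/

/-- The nodes of the binary tree are numbered from the top to the bottom and from the left to the
right, starting with `0`. `childIndex b h` is the number of the node that has, in the whole tree,
the position which the node `h` has in the left (`b = false`) or right (`b = true`) subtree. -/
def childIndex (b : Bool) (h : ℕ) : ℕ := h + 2 ^ Nat.log 2 (h + 1) * (1 + b.toNat)

/-- The labelling of the left or right subtree. -/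
def subtree {A : Type*} (b : Bool) (L : ℕ → A) : ℕ → A := fun h => L (childIndex b h)

/-- The depth of node h is d = log₂(h + 1), and level d starts at node 2^d - 1. Moving one level
down shifts the start by 2^d; the right half of the new level begins another 2^d later. -/
theorem log_childIndex (b : Bool) (h : ℕ) :
    Nat.log 2 (childIndex b h + 1) = Nat.log 2 (h + 1) + 1 := by
  have h1 : 2 ^ Nat.log 2 (h + 1) ≤ h + 1 := Nat.pow_log_le_self 2 (by omega)
  have h2 : h + 1 < 2 ^ (Nat.log 2 (h + 1) + 1) := Nat.lt_pow_succ_log_self (by omega) _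
  rw [Nat.log_eq_iff (by omega)]
  unfold childIndex
  rw [pow_succ] at h2
  rw [pow_succ, pow_succ]
  cases b <;> simp <;> omega

theorem edgeLabel_subtree (b : Bool) (L : ℕ → ℤ) {n k : ℕ} (hn : 1 ≤ n) (hk : k < 2 ^ n) :
    edgeLabel (subtree b L) n k = edgeLabel L (n + 1) (b.toNat * 2 ^ n + k) := by
  obtain ⟨n, rfl⟩ := Nat.exists_eq_succ_of_ne_zero (by omega : n ≠ 0)
  have hev : Even (b.toNat * 2 ^ (n + 1) + k) ↔ Even k := by
    rw [pow_succ, ← mul_assoc]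
    simp [Nat.even_add]
  unfold edgeLabel
  simp only [Nat.succ_eq_add_one, hev, Nat.add_sub_cancel]
  split_ifs with h
  · rfl
  obtain ⟨i, rfl⟩ := Nat.not_even_iff_odd.1 h
  have hi : i < 2 ^ n := by rw [Nat.succ_eq_add_one, pow_succ] at hk; omega
  have hpos : 0 < 2 ^ n := by positivity
  have hlog : Nat.log 2 (2 ^ n - 1 + i + 1) = n := by
    rw [Nat.log_eq_iff (by omega), pow_succ]
    omega
  have e1 : (2 * i + 1 - 1) / 2 = i := by omega
  unfold subtree childIndex
  rw [e1, hlog]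
  congr 1
  rw [pow_succ]
  cases b
  · simp; omega
  · simp; omega

theorem IsTreePath.lt {k : ℕ → ℕ} (hk : IsTreePath k) (n : ℕ) : k n < 2 ^ n := by
  induction n with
  | zero => simp [hk.1]
  | succ n ih => rw [pow_succ]; rcases hk.2 n with h | h <;> omega

/-- The sum of the first `n` terms along a path. -/
def pathSum (L : ℕ → ℤ) (k : ℕ → ℕ) (n : ℕ) : ℤ :=
  ∑ i ∈ Finset.range n, 4 ^ i * edgeLabel L (i + 1) (k (i + 1))

/-- Prepend an edge to a path. -/
def consPath (b : Bool) (k : ℕ → ℕ) : ℕ → ℕ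
  | 0 => 0
  | n + 1 => b.toNat * 2 ^ n + k n

theorem IsTreePath.cons {k : ℕ → ℕ} (hk : IsTreePath k) (b : Bool) :
    IsTreePath (consPath b k) := by
  refine ⟨rfl, fun n => ?_⟩
  cases n with
  | zero => cases b <;> simp [consPath, hk.1]
  | succ n =>
    simp only [consPath, pow_succ]
    rcases hk.2 n with h | h
    · left; rw [h]; ring
    · right; rw [h]; ring

theorem IsTreePath.exists_cons {k : ℕ → ℕ} (hk : IsTreePath k) :
    ∃ b k', IsTreePath k' ∧ k = consPath b k' := by
  obtain ⟨b, hb⟩ : ∃ b : Bool, k 1 = b.toNat := by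
    rcases hk.2 0 with h | h
    · exact ⟨false, by simpa [hk.1] using h⟩
    · exact ⟨true, by simpa [hk.1] using h⟩
  -- The first turn contributes b * 2^n to the edge number at level n + 1; this bound keeps the
  -- subtraction below from truncating.
  have hle : ∀ n, b.toNat * 2 ^ n ≤ k (n + 1) := by
    intro n
    induction n with
    | zero => simp [hb]
    | succ n ih => rw [pow_succ]; rcases hk.2 (n + 1) with h | h <;> rw [h] <;> nlinarith
  refine ⟨b, fun n => k (n + 1) - b.toNat * 2 ^ n, ⟨by simp [hb], fun n => ?_⟩, ?_⟩
  · have h1 := hle n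
    have h2 := hle (n + 1)
    beta_reduce
    rw [pow_succ, ← mul_assoc] at h2 ⊢
    rcases hk.2 (n + 1) with h | h
    · left; rw [h]; omega
    · right; rw [h]; omega
  · funext n
    cases n with
    | zero => exact hk.1
    | succ n => exact (Nat.add_sub_cancel' (hle n)).symm

theorem pathSum_consPath (L : ℕ → ℤ) {k : ℕ → ℕ} (hk : IsTreePath k) (b : Bool) (n : ℕ) :
    pathSum L (consPath b k) (n + 1) =
      (if b then L 0 else 0) + 4 * pathSum (subtree b L) k n := by
  unfold pathSum
  rw [Finset.sum_range_succ', Finset.mul_sum, add_comm]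
  congr 1
  · cases b <;> simp [consPath, hk.1, edgeLabel]
  · refine Finset.sum_congr rfl fun i _ => ?_
    rw [edgeLabel_subtree b L (by omega) (hk.lt (i + 1)), pow_succ]
    simp only [consPath]
    ring

/-- The path sums of length `n`. -/
def treeSums : ℕ → (ℕ → ℤ) → Finset ℤ
  | 0, _ => {0}
  | n + 1, L => (treeSums n (subtree false L)).image (fun x => 4 * x) ∪
      (treeSums n (subtree true L)).image (fun x => L 0 + 4 * x)

theorem mem_treeSums_succ {n : ℕ} {L : ℕ → ℤ} {x : ℤ} :
    x ∈ treeSums (n + 1) L ↔ (∃ y ∈ treeSums n (subtree false L), 4 * y = x) ∨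
      ∃ y ∈ treeSums n (subtree true L), L 0 + 4 * y = x := by
  simp [treeSums]

theorem mem_treeSums {n : ℕ} {L : ℕ → ℤ} {x : ℤ} :
    x ∈ treeSums n L ↔ ∃ k, IsTreePath k ∧ x = pathSum L k n := by
  induction n generalizing L x with
  | zero =>
    simp only [treeSums, Finset.mem_singleton, pathSum, Finset.range_zero, Finset.sum_empty]
    exact ⟨fun h => ⟨fun _ => 0, ⟨rfl, fun _ => Or.inl rfl⟩, h⟩, fun ⟨_, _, h⟩ => h⟩
  | succ n ih =>
    rw [mem_treeSums_succ]
    constructor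
    · rintro (⟨y, hy, rfl⟩ | ⟨y, hy, rfl⟩)
      · obtain ⟨k, hk, rfl⟩ := ih.1 hy
        exact ⟨consPath false k, hk.cons _, by simp [pathSum_consPath L hk]⟩
      · obtain ⟨k, hk, rfl⟩ := ih.1 hy
        exact ⟨consPath true k, hk.cons _, by simp [pathSum_consPath L hk]⟩
    · rintro ⟨k, hk, rfl⟩
      obtain ⟨b, k', hk', rfl⟩ := hk.exists_cons
      rw [pathSum_consPath L hk']
      cases b
      · exact Or.inl ⟨_, ih.2 ⟨k', hk', rfl⟩, by simp⟩
      · exact Or.inr ⟨_, ih.2 ⟨k', hk', rfl⟩, by simp⟩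

/-- A path can be prolonged by a left edge, whose label is 0. -/
theorem treeSums_subset_succ (n : ℕ) (L : ℕ → ℤ) : treeSums n L ⊆ treeSums (n + 1) L := by
  induction n generalizing L with
  | zero =>
    intro x hx
    rw [mem_treeSums_succ]
    simp_all [treeSums]
  | succ n ih =>
    intro x hx
    rw [mem_treeSums_succ] at hx ⊢
    rcases hx with ⟨y, hy, rfl⟩ | ⟨y, hy, rfl⟩
    · exact Or.inl ⟨y, ih _ hy, rfl⟩
    · exact Or.inr ⟨y, ih _ hy, rfl⟩

theorem monotone_treeSums (L : ℕ → ℤ) : Monotone fun n => treeSums n L :=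
  monotone_nat_of_le_succ fun n => treeSums_subset_succ n L

theorem mem_treeSet {L : ℕ → ℤ} {x : ℝ} :
    x ∈ treeSet L ↔ ∃ n, ∃ y ∈ treeSums n L, x = (y : ℝ) := by
  have hsum : ∀ (k : ℕ → ℕ) (n : ℕ),
      ∑ i ∈ Finset.Icc 1 n, 4 ^ (i - 1) * edgeLabel L i (k i) = pathSum L k n := by
    intro k n
    unfold pathSum
    induction n with
    | zero => simp
    | succ n ih => rw [Finset.sum_Icc_succ_top (by omega), ih, Finset.sum_range_succ]; rfl
  constructor
  · rintro ⟨k, hk, n, -, rfl⟩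
    exact ⟨n, _, mem_treeSums.2 ⟨k, hk, rfl⟩, by rw [hsum]⟩
  · rintro ⟨n, y, hy, rfl⟩
    -- One more edge, since `treeSet` demands length at least 1.
    obtain ⟨k, hk, rfl⟩ := mem_treeSums.1 (treeSums_subset_succ n L hy)
    exact ⟨k, hk, n + 1, by omega, by rw [hsum]⟩

/-! ### The Fourier transform of the Cantor measure -/

theorem continuous_expFun (ξ : ℝ) : Continuous (expFun ξ) := by
  unfold expFun
  fun_prop

theorem expFun_add (ξ η x : ℝ) : expFun (ξ + η) x = expFun ξ x * expFun η x := by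
  rw [expFun, expFun, expFun, ← Complex.exp_add]
  push_cast
  ring_nf

theorem norm_expFun (ξ x : ℝ) : ‖expFun ξ x‖ = 1 := by
  have h : (2 * Real.pi * Complex.I * ξ * x : ℂ)
      = ((2 * Real.pi * ξ * x : ℝ) : ℂ) * Complex.I := by push_cast; ring
  rw [expFun, h, Complex.norm_exp_ofReal_mul_I]

theorem conj_expFun (ξ x : ℝ) : (starRingEnd ℂ) (expFun ξ x) = expFun (-ξ) x := by
  unfold expFun
  rw [← Complex.exp_conj]
  congr 1
  simp [Complex.conj_ofNat]

theorem integrable_expFun (μ : Measure ℝ) [IsFiniteMeasure μ] (ξ : ℝ) :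
    Integrable (expFun ξ) μ :=
  (memLp_expFun μ ξ).integrable (by norm_num)

/-- The Fourier transform of `μ₄`. -/
noncomputable def cantorFourier (ξ : ℝ) : ℂ := ∫ x, expFun ξ x ∂muFour

theorem cantorFourier_eq (ξ : ℝ) :
    cantorFourier ξ =
      (1 + Complex.exp (Real.pi * ξ * Complex.I)) / 2 * cantorFourier (ξ / 4) := by
  have hτ : ∀ c : ℝ, Measurable fun x : ℝ => (x + c) / 4 := fun c => by fun_prop
  have hmap : ∀ c : ℝ, ∫ x, expFun ξ x ∂(muFour.map fun x : ℝ => (x + c) / 4) =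
      Complex.exp (Real.pi * ξ * (c / 2) * Complex.I) * cantorFourier (ξ / 4) := by
    intro c
    rw [integral_map (hτ c).aemeasurable (continuous_expFun ξ).aestronglyMeasurable,
      cantorFourier, ← integral_const_mul]
    refine integral_congr_ae (Filter.Eventually.of_forall fun x => ?_)
    simp only [expFun]
    rw [← Complex.exp_add]
    push_cast
    ring_nf
  have h0 := hmap 0
  have h2 := hmap 2
  simp only [add_zero] at h0
  have hint : ∀ c : ℝ, Integrable (expFun ξ) (muFour.map fun x : ℝ => (x + c) / 4) := fun c => by
    have := Measure.isProbabilityMeasure_map (μ := muFour) (hτ c).aemeasurable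
    exact integrable_expFun _ ξ
  have hint0 := hint 0
  simp only [add_zero] at hint0
  conv_lhs => rw [cantorFourier, muFour_invariant]
  rw [integral_add_measure (hint0.smul_measure (by simp)) ((hint 2).smul_measure (by simp)),
    integral_smul_measure, integral_smul_measure, h0, h2]
  simp only [ENNReal.toReal_inv, ENNReal.toReal_ofNat, Complex.real_smul]
  push_cast
  simp
  ring

theorem cantorFourier_zero : cantorFourier 0 = 1 := by
  simp [cantorFourier, expFun]

theorem norm_cantorFourier_le (ξ : ℝ) : ‖cantorFourier ξ‖ ≤ 1 := by
  refine (norm_integral_le_integral_norm _).trans ?_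
  simp [norm_expFun]

theorem continuous_cantorFourier : Continuous cantorFourier := by
  unfold cantorFourier
  refine continuous_of_dominated (bound := fun _ => 1)
    (fun ξ => (continuous_expFun ξ).aestronglyMeasurable)
    (fun ξ => Filter.Eventually.of_forall fun x => (norm_expFun ξ x).le)
    (integrable_const _) (Filter.Eventually.of_forall fun x => ?_)
  unfold expFun
  fun_prop

/-- The squared modulus of the Fourier transform of `μ₄`. -/
noncomputable def cantorPower (ξ : ℝ) : ℝ := ‖cantorFourier ξ‖ ^ 2

/-- The squared modulus of the mask `(1 + exp (π i ξ)) / 2`. -/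
noncomputable def maskPower (ξ : ℝ) : ℝ := (1 + Real.cos (Real.pi * ξ)) / 2

theorem cantorPower_eq (ξ : ℝ) : cantorPower ξ = maskPower ξ * cantorPower (ξ / 4) := by
  unfold cantorPower
  rw [cantorFourier_eq ξ, norm_mul, mul_pow]
  congr 1
  have h : ((1 + Complex.exp (Real.pi * ξ * Complex.I)) / 2 : ℂ) =
      (((1 + Real.cos (Real.pi * ξ)) / 2 : ℝ) : ℂ) + ((Real.sin (Real.pi * ξ) / 2 : ℝ) : ℂ) *
        Complex.I := by
    rw [← Complex.ofReal_mul, Complex.exp_mul_I, ← Complex.ofReal_cos, ← Complex.ofReal_sin]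
    push_cast
    ring
  rw [h, ← Complex.normSq_eq_norm_sq, Complex.normSq_add_mul_I, maskPower]
  nlinarith [Real.sin_sq_add_cos_sq (Real.pi * ξ)]

theorem continuous_cantorPower : Continuous cantorPower :=
  continuous_cantorFourier.norm.pow 2

theorem cantorPower_zero : cantorPower 0 = 1 := by simp [cantorPower, cantorFourier_zero]

theorem cantorPower_nonneg (ξ : ℝ) : 0 ≤ cantorPower ξ := by unfold cantorPower; positivity

theorem cantorPower_le_one (ξ : ℝ) : cantorPower ξ ≤ 1 :=
  pow_le_one₀ (norm_nonneg _) (norm_cantorFourier_le ξ)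

theorem continuous_maskPower : Continuous maskPower := by unfold maskPower; fun_prop

theorem maskPower_nonneg (ξ : ℝ) : 0 ≤ maskPower ξ := by
  unfold maskPower
  linarith [Real.neg_one_le_cos (Real.pi * ξ)]

theorem maskPower_add_four_mul (ξ : ℝ) (n : ℤ) : maskPower (ξ + 4 * n) = maskPower ξ := by
  unfold maskPower
  rw [show Real.pi * (ξ + 4 * n) = Real.pi * ξ + ((2 * n : ℤ) : ℝ) * (2 * Real.pi) by
    push_cast; ring, Real.cos_add_int_mul_two_pi]

/-- An odd shift changes the sign of the cosine. This makes the two weights at a node add up to 1.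
-/
theorem maskPower_add_odd (ξ : ℝ) {a : ℤ} (ha : Odd a) :
    maskPower (ξ + a) = 1 - maskPower ξ := by
  obtain ⟨n, rfl⟩ := ha
  unfold maskPower
  rw [show Real.pi * (ξ + ((2 * n + 1 : ℤ) : ℝ)) =
      Real.pi * ξ + Real.pi + (n : ℝ) * (2 * Real.pi) by push_cast; ring,
    Real.cos_add_int_mul_two_pi, Real.cos_add_pi]
  ring

theorem maskPower_odd {a : ℤ} (ha : Odd a) : maskPower a = 0 := by
  have := maskPower_add_odd 0 ha
  rw [zero_add] at this
  rw [this]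
  simp [maskPower]

theorem exists_odd_of_maskPower_eq_zero {ξ : ℝ} (h : maskPower ξ = 0) :
    ∃ a : ℤ, Odd a ∧ ξ = a := by
  have hc : Real.cos (Real.pi * ξ) = -1 := by unfold maskPower at h; linarith
  obtain ⟨n, hn⟩ := (Real.cos_eq_neg_one_iff).1 hc
  refine ⟨2 * n + 1, ⟨n, rfl⟩, ?_⟩
  have hpi := Real.pi_ne_zero
  apply mul_left_cancel₀ hpi
  rw [← hn]
  push_cast
  ring

theorem cantorPower_odd {a : ℤ} (ha : Odd a) : cantorPower a = 0 := by
  rw [cantorPower_eq, maskPower_odd ha, zero_mul]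

theorem cantorPower_four_mul {ξ : ℝ} (h : cantorPower ξ = 0) : cantorPower (4 * ξ) = 0 := by
  rw [cantorPower_eq, mul_div_cancel_left₀ _ (by norm_num), h, mul_zero]

/-! ### Exponentials in `L²(μ₄)` -/

theorem inner_expLp (ξ η : ℝ) :
    inner ℂ (expLp muFour ξ) (expLp muFour η) = cantorFourier (η - ξ) := by
  rw [L2.inner_def, cantorFourier]
  refine integral_congr_ae ?_
  filter_upwards [(memLp_expFun muFour ξ).coeFn_toLp, (memLp_expFun muFour η).coeFn_toLp]
    with x h1 h2
  rw [expLp, expLp, h1, h2, RCLike.inner_apply, conj_expFun, ← expFun_add, ← sub_eq_add_neg]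

theorem norm_inner_expLp_sq (ξ η : ℝ) :
    ‖(inner ℂ (expLp muFour ξ) (expLp muFour η) : ℂ)‖ ^ 2 = cantorPower (η - ξ) := by
  rw [inner_expLp, cantorPower]

theorem norm_expLp (ξ : ℝ) : ‖expLp muFour ξ‖ = 1 := by
  have h := inner_self_eq_norm_sq_to_K (𝕜 := ℂ) (expLp muFour ξ)
  rw [inner_expLp, sub_self, cantorFourier_zero] at h
  have h2 : ‖expLp muFour ξ‖ ^ 2 = 1 := Complex.ofReal_injective (by push_cast; exact h.symm)
  nlinarith [norm_nonneg (expLp muFour ξ)]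

/-- The positive and negative parts of g are densities of two finite measures with the same
characteristic function; these measures coincide, so the parts agree almost everywhere. -/
theorem ae_eq_zero_of_integral_expFun_mul_ofReal {μ : Measure ℝ} [IsFiniteMeasure μ] {g : ℝ → ℝ}
    (hg : Integrable g μ) (h : ∀ ξ, ∫ x, expFun ξ x * (g x : ℂ) ∂μ = 0) : g =ᵐ[μ] 0 := by
  have hfin : ∀ {f : ℝ → ℝ}, Integrable f μ →
      IsFiniteMeasure (μ.withDensity fun x => ENNReal.ofReal (f x)) := fun hf =>
    isFiniteMeasure_withDensity_ofReal hf.2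
  have := hfin hg
  have := hfin hg.neg
  have hchar : ∀ {f : ℝ → ℝ}, Integrable f μ → ∀ t : ℝ,
      charFun (μ.withDensity fun x => ENNReal.ofReal (f x)) t =
        ∫ x, expFun (t / (2 * Real.pi)) x * ((max (f x) 0 : ℝ) : ℂ) ∂μ := by
    intro f hf t
    rw [charFun_apply_real, integral_withDensity_eq_integral_toReal_smul₀
      hf.1.aemeasurable.ennreal_ofReal (Filter.Eventually.of_forall fun _ => ENNReal.ofReal_lt_top)]
    refine integral_congr_ae (Filter.Eventually.of_forall fun x => ?_)
    simp only [ENNReal.toReal_ofReal', Complex.real_smul, expFun]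
    rw [mul_comm]
    congr 2
    have := Complex.ofReal_ne_zero.2 Real.pi_ne_zero
    push_cast
    field_simp
  have hi : ∀ {f : ℝ → ℝ}, Integrable f μ → ∀ ξ,
      Integrable (fun x => expFun ξ x * ((max (f x) 0 : ℝ) : ℂ)) μ := fun hf ξ =>
    (hf.pos_part.ofReal (𝕜 := ℂ)).bdd_mul (continuous_expFun ξ).aestronglyMeasurable
      (Filter.Eventually.of_forall fun x => (norm_expFun ξ x).le)
  have heq : (μ.withDensity fun x => ENNReal.ofReal (g x)) =
      μ.withDensity fun x => ENNReal.ofReal ((-g) x) := by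
    refine Measure.ext_of_charFun (funext fun t => ?_)
    rw [hchar hg, hchar hg.neg, ← sub_eq_zero, ← integral_sub (hi hg _) (hi hg.neg _),
      ← h (t / (2 * Real.pi))]
    refine integral_congr_ae (Filter.Eventually.of_forall fun x => ?_)
    simp only [← mul_sub, ← Complex.ofReal_sub, Pi.neg_apply]
    congr 2
    rcases le_total 0 (g x) with hx | hx
    · rw [max_eq_left hx, max_eq_right (by linarith), sub_zero]
    · rw [max_eq_right hx, max_eq_left (by linarith)]; ring
  rw [withDensity_eq_iff hg.1.aemeasurable.ennreal_ofReal hg.neg.1.aemeasurable.ennreal_ofReal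
    hg.lintegral_lt_top.ne] at heq
  filter_upwards [heq] with x hx
  rw [Pi.neg_apply] at hx
  rcases le_total 0 (g x) with h0 | h0
  · rw [ENNReal.ofReal_of_nonpos (show -g x ≤ 0 by linarith), ENNReal.ofReal_eq_zero] at hx
    exact le_antisymm hx h0
  · rw [ENNReal.ofReal_of_nonpos h0, eq_comm, ENNReal.ofReal_eq_zero] at hx
    exact le_antisymm h0 (neg_nonpos.1 hx)

theorem ae_eq_zero_of_integral_expFun_mul {μ : Measure ℝ} [IsFiniteMeasure μ] {f : ℝ → ℂ}
    (hf : Integrable f μ) (h : ∀ ξ, ∫ x, expFun ξ x * f x ∂μ = 0) : f =ᵐ[μ] 0 := by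
  have hconj : ∀ ξ, ∫ x, expFun ξ x * (starRingEnd ℂ) (f x) ∂μ = 0 := by
    intro ξ
    rw [← map_zero (starRingEnd ℂ), ← h (-ξ), ← integral_conj]
    refine integral_congr_ae (Filter.Eventually.of_forall fun x => ?_)
    simp only [map_mul, conj_expFun, neg_neg]
  have hb : ∀ {g : ℝ → ℂ}, Integrable g μ → ∀ ξ, Integrable (fun x => expFun ξ x * g x) μ :=
    fun hg ξ => hg.bdd_mul (continuous_expFun ξ).aestronglyMeasurable
      (Filter.Eventually.of_forall fun x => (norm_expFun ξ x).le)
  have hfc : Integrable (fun x => (starRingEnd ℂ) (f x)) μ :=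
    (LinearIsometryEquiv.integrable_comp_iff Complex.conjLIE).2 hf
  have hre : (fun x => (f x).re) =ᵐ[μ] 0 := by
    refine ae_eq_zero_of_integral_expFun_mul_ofReal hf.re fun ξ => ?_
    have : ∀ x, expFun ξ x * ((f x).re : ℂ) =
        (1 / 2 : ℂ) * (expFun ξ x * f x + expFun ξ x * (starRingEnd ℂ) (f x)) := fun x => by
      rw [Complex.re_eq_add_conj]; ring
    simp only [this]
    rw [integral_const_mul, integral_add (hb hf ξ) (hb hfc ξ), h, hconj]
    simp
  have him : (fun x => (f x).im) =ᵐ[μ] 0 := by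
    refine ae_eq_zero_of_integral_expFun_mul_ofReal hf.im fun ξ => ?_
    have : ∀ x, expFun ξ x * ((f x).im : ℂ) =
        (1 / (2 * Complex.I) : ℂ) * (expFun ξ x * f x - expFun ξ x * (starRingEnd ℂ) (f x)) :=
      fun x => by rw [Complex.im_eq_sub_conj]; ring
    simp only [this]
    rw [integral_const_mul, integral_sub (hb hf ξ) (hb hfc ξ), h, hconj]
    simp
  filter_upwards [hre, him] with x h1 h2
  exact Complex.ext h1 h2

theorem topologicalClosure_eq_top_of_expLp_mem {μ : Measure ℝ} [IsFiniteMeasure μ]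
    {K : Submodule ℂ (Lp ℂ 2 μ)} (h : ∀ ξ, expLp μ ξ ∈ K.topologicalClosure) :
    K.topologicalClosure = ⊤ := by
  rw [Submodule.topologicalClosure_eq_top_iff, Submodule.eq_bot_iff]
  intro f hf
  rw [← Submodule.orthogonal_closure, Submodule.mem_orthogonal] at hf
  have hint : Integrable f μ := (Lp.memLp f).integrable (by norm_num)
  rw [Lp.eq_zero_iff_ae_eq_zero]
  refine ae_eq_zero_of_integral_expFun_mul hint fun ξ => ?_
  rw [← hf _ (h (-ξ)), L2.inner_def]
  refine integral_congr_ae ?_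
  filter_upwards [(memLp_expFun μ (-ξ)).coeFn_toLp] with x hx
  rw [expLp, hx, RCLike.inner_apply, conj_expFun, neg_neg, mul_comm]

/-! ### Orthogonality and completeness of the exponentials of a labelled tree -/

theorem odd_add_four_mul {a : ℤ} (ha : Odd a) (b : ℤ) : Odd (a + 4 * b) :=
  ha.add_even (Even.mul_right (by decide) b)

/-- If the two paths separate after j common edges, the difference is 4^j times an odd integer, a
zero of μ̂₄. -/
theorem cantorPower_sub_eq_zero {n : ℕ} {L : ℕ → ℤ} (hL : ∀ i, Odd (L i)) {x y : ℤ}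
    (hx : x ∈ treeSums n L) (hy : y ∈ treeSums n L) (hxy : x ≠ y) :
    cantorPower ((x : ℝ) - y) = 0 := by
  induction n generalizing L x y with
  | zero => simp_all [treeSums]
  | succ n ih =>
    have hsame : ∀ b, ∀ u ∈ treeSums n (subtree b L), ∀ v ∈ treeSums n (subtree b L), u ≠ v →
        cantorPower (4 * ((u : ℝ) - v)) = 0 := fun b u hu v hv huv =>
      cantorPower_four_mul (ih (fun i => hL _) hu hv huv)
    rw [mem_treeSums_succ] at hx hy
    rcases hx with ⟨u, hu, rfl⟩ | ⟨u, hu, rfl⟩ <;> rcases hy with ⟨v, hv, rfl⟩ | ⟨v, hv, rfl⟩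
    · rw [show ((4 * u : ℤ) : ℝ) - ((4 * v : ℤ) : ℝ) = 4 * ((u : ℝ) - v) by push_cast; ring]
      exact hsame _ u hu v hv fun h => hxy (by rw [h])
    · rw [← Int.cast_sub, show 4 * u - (L 0 + 4 * v) = -L 0 + 4 * (u - v) by ring]
      exact cantorPower_odd (odd_add_four_mul (hL 0).neg _)
    · rw [← Int.cast_sub, show L 0 + 4 * u - 4 * v = L 0 + 4 * (u - v) by ring]
      exact cantorPower_odd (odd_add_four_mul (hL 0) _)
    · rw [show ((L 0 + 4 * u : ℤ) : ℝ) - ((L 0 + 4 * v : ℤ) : ℝ) = 4 * ((u : ℝ) - v) by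
        push_cast; ring]
      exact hsame _ u hu v hv fun h => hxy (by rw [h])

theorem orthonormal_expLp {ι : Type*} {f : ι → ℝ}
    (hf : ∀ i j, i ≠ j → cantorPower (f i - f j) = 0) :
    Orthonormal ℂ fun i => expLp muFour (f i) := by
  refine ⟨fun i => norm_expLp _, fun i j hij => ?_⟩
  have h := norm_inner_expLp_sq (f i) (f j)
  rw [hf j i hij.symm] at h
  exact norm_eq_zero.1 (pow_eq_zero_iff two_ne_zero |>.1 h)

/-- The sum of `|μ̂₄(ξ + λ)|²` over the path sums `λ` of length `n`. -/
noncomputable def levelPower (n : ℕ) (L : ℕ → ℤ) (ξ : ℝ) : ℝ :=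
  ∑ y ∈ treeSums n L, cantorPower (ξ + y)

theorem levelPower_zero (L : ℕ → ℤ) (ξ : ℝ) : levelPower 0 L ξ = cantorPower ξ := by
  simp [levelPower, treeSums]

/-- The refinement equation of |μ̂₄|² is applied to each term; the mask has period 4, so it is a
common factor in each subtree. The two halves are disjoint by parity. -/
theorem levelPower_succ {L : ℕ → ℤ} (hL : Odd (L 0)) (n : ℕ) (ξ : ℝ) :
    levelPower (n + 1) L ξ = maskPower ξ * levelPower n (subtree false L) (ξ / 4) +
      maskPower (ξ + L 0) * levelPower n (subtree true L) ((ξ + L 0) / 4) := by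
  have hp : ∀ (η : ℝ) (y : ℤ),
      cantorPower (η + 4 * y) = maskPower η * cantorPower (η / 4 + y) := fun η y => by
    rw [cantorPower_eq, maskPower_add_four_mul]
    congr 2
    ring
  unfold levelPower
  rw [treeSums, Finset.sum_union, Finset.sum_image, Finset.sum_image, Finset.mul_sum,
    Finset.mul_sum]
  · congr 1
    · refine Finset.sum_congr rfl fun y _ => ?_
      rw [← hp]; push_cast; rfl
    · refine Finset.sum_congr rfl fun y _ => ?_
      rw [← hp]; push_cast; ring_nf
  · intro a _ b _ h; simpa using h
  · intro a _ b _ h; simpa using h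
  · rw [Finset.disjoint_left]
    rintro x hx hy
    obtain ⟨a, -, rfl⟩ := Finset.mem_image.1 hx
    obtain ⟨b, -, h⟩ := Finset.mem_image.1 hy
    obtain ⟨c, hc⟩ := hL
    omega

theorem monotone_levelPower (L : ℕ → ℤ) (ξ : ℝ) : Monotone fun n => levelPower n L ξ :=
  fun _ _ h => Finset.sum_le_sum_of_subset_of_nonneg (monotone_treeSums L h)
    fun _ _ _ => cantorPower_nonneg _

theorem levelPower_le_one {L : ℕ → ℤ} (hL : ∀ i, Odd (L i)) (n : ℕ) (ξ : ℝ) :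
    levelPower n L ξ ≤ 1 := by
  induction n generalizing L ξ with
  | zero => rw [levelPower_zero]; exact cantorPower_le_one ξ
  | succ n ih =>
    rw [levelPower_succ (hL 0)]
    have h1 := mul_le_mul_of_nonneg_left (ih (L := subtree false L) (fun i => hL _) (ξ / 4))
      (maskPower_nonneg ξ)
    have h2 := mul_le_mul_of_nonneg_left
      (ih (L := subtree true L) (fun i => hL _) ((ξ + L 0) / 4)) (maskPower_nonneg (ξ + L 0))
    have h3 := maskPower_add_odd ξ (hL 0)
    linarith

/-- The sum of `|μ̂₄(ξ + λ)|²` over all `λ` in the set `Λ(L)`. -/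
noncomputable def totalPower (L : ℕ → ℤ) (ξ : ℝ) : ℝ := ⨆ n, levelPower n L ξ

theorem bddAbove_levelPower {L : ℕ → ℤ} (hL : ∀ i, Odd (L i)) (ξ : ℝ) :
    BddAbove (Set.range fun n => levelPower n L ξ) :=
  ⟨1, by rintro _ ⟨n, rfl⟩; exact levelPower_le_one hL n ξ⟩

theorem tendsto_levelPower {L : ℕ → ℤ} (hL : ∀ i, Odd (L i)) (ξ : ℝ) :
    Filter.Tendsto (fun n => levelPower n L ξ) Filter.atTop (nhds (totalPower L ξ)) :=
  tendsto_atTop_ciSup (monotone_levelPower L ξ) (bddAbove_levelPower hL ξ)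

theorem totalPower_eq {L : ℕ → ℤ} (hL : ∀ i, Odd (L i)) (ξ : ℝ) :
    totalPower L ξ = maskPower ξ * totalPower (subtree false L) (ξ / 4) +
      maskPower (ξ + L 0) * totalPower (subtree true L) ((ξ + L 0) / 4) := by
  refine tendsto_nhds_unique ((tendsto_levelPower hL ξ).comp (Filter.tendsto_add_atTop_nat 1)) ?_
  simp only [Function.comp_def, levelPower_succ (hL 0)]
  exact ((tendsto_levelPower (L := subtree false L) (fun i => hL _) _).const_mul _).add
    ((tendsto_levelPower (L := subtree true L) (fun i => hL _) _).const_mul _)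

theorem cantorPower_le_totalPower {L : ℕ → ℤ} (hL : ∀ i, Odd (L i)) (ξ : ℝ) :
    cantorPower ξ ≤ totalPower L ξ := by
  rw [← levelPower_zero L]
  exact le_ciSup (bddAbove_levelPower hL ξ) 0

/-- By Bessel, h_L(-ξ) is at most the squared norm of the projection of e_ξ to the closed span. The
value 1 therefore puts every e_ξ in the span, and all exponentials together are total. -/
theorem isSpectrum_of_totalPower_eq_one {L : ℕ → ℤ} (hL : ∀ i, Odd (L i))
    (h : ∀ ξ, totalPower L ξ = 1) : IsSpectrum muFour (treeSet L) := by
  constructor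
  · refine orthonormal_expLp fun i j hij => ?_
    obtain ⟨m, x, hx, hix⟩ := mem_treeSet.1 i.2
    obtain ⟨n, y, hy, hjy⟩ := mem_treeSet.1 j.2
    rw [hix, hjy]
    refine cantorPower_sub_eq_zero hL (monotone_treeSums L (le_max_left m n) hx)
      (monotone_treeSums L (le_max_right m n) hy) fun hxy => hij (Subtype.ext ?_)
    rw [hix, hjy, hxy]
  · refine topologicalClosure_eq_top_of_expLp_mem fun ξ => ?_
    set K := (Submodule.span ℂ
      (Set.range fun ξ : treeSet L => expLp muFour (ξ : ℝ))).topologicalClosure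
    have : CompleteSpace K :=
      (Submodule.isClosed_topologicalClosure _).completeSpace_coe
    have hmem : ∀ n, ∀ y ∈ treeSums n L, expLp muFour (y : ℝ) ∈ K := fun n y hy =>
      Submodule.le_topologicalClosure _
        (Submodule.subset_span ⟨⟨y, mem_treeSet.2 ⟨n, y, hy, rfl⟩⟩, rfl⟩)
    rw [Submodule.mem_iff_norm_starProjection, norm_expLp]
    refine le_antisymm ((K.norm_starProjection_apply_le _).trans (norm_expLp ξ).le) ?_
    -- Bessel's inequality is applied to the projection itself, whose inner products with the e_y
    -- are those of e_ξ.
    have hle : ∀ n, levelPower n L (-ξ) ≤ ‖K.starProjection (expLp muFour ξ)‖ ^ 2 := by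
      intro n
      have ho : Orthonormal ℂ fun y : treeSums n L => expLp muFour ((y : ℤ) : ℝ) :=
        orthonormal_expLp fun i j hij =>
          cantorPower_sub_eq_zero hL i.2 j.2 fun h => hij (Subtype.ext h)
      refine le_trans (le_of_eq ?_)
        (ho.sum_inner_products_le (s := Finset.univ) (K.starProjection (expLp muFour ξ)))
      rw [levelPower, ← Finset.sum_coe_sort]
      refine Finset.sum_congr rfl fun y _ => ?_
      rw [← Submodule.inner_starProjection_left_eq_right,
        Submodule.starProjection_eq_self_iff.2 (hmem n y y.2), norm_inner_symm,
        norm_inner_expLp_sq]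
      congr 1
      ring
    have hone : 1 ≤ ‖K.starProjection (expLp muFour ξ)‖ ^ 2 := by
      rw [← h (-ξ)]
      exact ciSup_le hle
    nlinarith [norm_nonneg (K.starProjection (expLp muFour ξ))]

theorem not_isSpectrum_of_cantorPower_eq_zero {L : ℕ → ℤ} {ξ : ℝ}
    (h : ∀ n, ∀ y ∈ treeSums n L, cantorPower (ξ + y) = 0) :
    ¬ IsSpectrum muFour (treeSet L) := by
  rintro ⟨-, htop⟩
  rw [Submodule.topologicalClosure_eq_top_iff] at htop
  have hmem : expLp muFour (-ξ) ∈ (Submodule.span ℂ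
      (Set.range fun ξ : treeSet L => expLp muFour (ξ : ℝ)))ᗮ := by
    rw [Submodule.mem_orthogonal]
    intro u hu
    induction hu using Submodule.span_induction with
    | mem x hx =>
      obtain ⟨⟨l, hl⟩, rfl⟩ := hx
      obtain ⟨n, y, hy, rfl⟩ := mem_treeSet.1 hl
      have h2 := norm_inner_expLp_sq (-ξ) y
      rw [sub_neg_eq_add, add_comm, h n y hy] at h2
      rw [← norm_eq_zero, norm_inner_symm]
      exact pow_eq_zero_iff two_ne_zero |>.1 h2
    | zero => simp
    | add x y _ _ hx hy => rw [inner_add_left, hx, hy, add_zero]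
    | smul a x _ hx => rw [inner_smul_left, hx, mul_zero]
  rw [htop, Submodule.mem_bot] at hmem
  have := norm_expLp (-ξ)
  rw [hmem] at this
  simp at this

/-! ### Invariant sets of integers -/

/-- There is a nonempty set of nonzero integers each of whose elements `z` has a successor
`z / 4` or `(z + c) / 4` with `c ∈ C` in the set. -/
def HasInvariantSet (C : Finset ℤ) : Prop :=
  ∃ Z : Set ℤ, Z.Nonempty ∧ 0 ∉ Z ∧ ∀ z ∈ Z, ∃ z' ∈ Z, 4 * z' = z ∨ ∃ c ∈ C, 4 * z' = z + c

/-- A labelling by elements of `C` as a labelling by integers. -/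
def intLabels {C : Finset ℤ} (L : ℕ → C) : ℕ → ℤ := fun i => L i

theorem continuous_subtree {A : Type*} [TopologicalSpace A] (b : Bool) :
    Continuous (subtree b : (ℕ → A) → ℕ → A) :=
  continuous_pi fun h => continuous_apply (childIndex b h)

theorem continuous_levelPower {C : Finset ℤ} (hC : ∀ c ∈ C, Odd c) (n : ℕ) :
    Continuous fun p : (ℕ → C) × ℝ => levelPower n (intLabels p.1) p.2 := by
  induction n with
  | zero =>
    simp only [levelPower_zero]
    exact continuous_cantorPower.comp continuous_snd
  | succ n ih =>
    have hsucc : ∀ p : (ℕ → C) × ℝ, levelPower (n + 1) (intLabels p.1) p.2 =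
        maskPower p.2 * levelPower n (intLabels (subtree false p.1)) (p.2 / 4) +
        maskPower (p.2 + (p.1 0 : ℤ)) *
          levelPower n (intLabels (subtree true p.1)) ((p.2 + (p.1 0 : ℤ)) / 4) :=
      fun p => levelPower_succ (hC _ (p.1 0).2) n p.2
    have h0 : Continuous fun p : (ℕ → C) × ℝ => p.2 + ((p.1 0 : ℤ) : ℝ) :=
      continuous_snd.add ((continuous_of_discreteTopology (f := fun c : C => ((c : ℤ) : ℝ))).comp
        ((continuous_apply 0).comp continuous_fst))
    have hpl : Continuous fun p : (ℕ → C) × ℝ => (subtree false p.1, p.2 / 4) :=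
      ((continuous_subtree false).comp continuous_fst).prodMk (continuous_snd.div_const 4)
    have hpr : Continuous fun p : (ℕ → C) × ℝ =>
        (subtree true p.1, (p.2 + ((p.1 0 : ℤ) : ℝ)) / 4) :=
      ((continuous_subtree true).comp continuous_fst).prodMk (h0.div_const 4)
    have hl := ih.comp hpl
    have hr := ih.comp hpr
    have hm : Continuous fun p : (ℕ → C) × ℝ => maskPower p.2 :=
      continuous_maskPower.comp continuous_snd
    have hm' : Continuous fun p : (ℕ → C) × ℝ => maskPower (p.2 + (p.1 0 : ℤ)) :=
      continuous_maskPower.comp h0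
    exact (continuous_congr hsucc).2 ((hm.mul hl).add (hm'.mul hr))

theorem odd_intLabels {C : Finset ℤ} (hC : ∀ c ∈ C, Odd c) (L : ℕ → C) (i : ℕ) :
    Odd (intLabels L i) :=
  hC _ (L i).2

/-- A supremum of continuous functions is lower semicontinuous, so it attains its minimum on the
compact space C^∞ × [-M, M]. -/
theorem exists_forall_totalPower_le {C : Finset ℤ} (hC : ∀ c ∈ C, Odd c) (L : ℕ → C) {M : ℝ}
    (hM : 0 ≤ M) : ∃ (L₀ : ℕ → C) (x₀ : ℝ), |x₀| ≤ M ∧ ∀ (L : ℕ → C) (x : ℝ), |x| ≤ M →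
      totalPower (intLabels L₀) x₀ ≤ totalPower (intLabels L) x := by
  have hcpt : IsCompact ((Set.univ : Set (ℕ → C)) ×ˢ Set.Icc (-M) M) :=
    isCompact_univ.prod isCompact_Icc
  have hlsc : LowerSemicontinuous fun p : (ℕ → C) × ℝ => totalPower (intLabels p.1) p.2 :=
    lowerSemicontinuous_ciSup (fun p => bddAbove_levelPower (odd_intLabels hC p.1) p.2)
      fun n => (continuous_levelPower hC n).lowerSemicontinuous
  have hne : ((Set.univ : Set (ℕ → C)) ×ˢ Set.Icc (-M) M).Nonempty :=
    ⟨(L, 0), ⟨Set.mem_univ _, by simpa using hM, hM⟩⟩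
  obtain ⟨⟨L₀, x₀⟩, ⟨-, hx₀⟩, hmin⟩ :=
    (hlsc.lowerSemicontinuousOn _).exists_isMinOn hne hcpt
  rw [isMinOn_iff] at hmin
  exact ⟨L₀, x₀, abs_le.2 hx₀, fun L x hx => hmin (L, x) ⟨Set.mem_univ _, abs_le.1 hx⟩⟩

/-! ### Propagation of the minimum along the tree. -/

section Minimizers

variable {C : Finset ℤ} {M q : ℝ}

/-- An average equals the lower bound q only if every entry of positive weight does. The bound |c| ≤
M keeps x/4 and (x + c)/4 in [-M, M]. -/
theorem totalPower_subtree_false (hC : ∀ c ∈ C, Odd c) (hMC : ∀ c ∈ C, |(c : ℝ)| ≤ M)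
    (hq : ∀ (L : ℕ → C) (x : ℝ), |x| ≤ M → q ≤ totalPower (intLabels L) x)
    {L : ℕ → C} {x : ℝ} (hx : |x| ≤ M) (h : totalPower (intLabels L) x = q)
    (h0 : maskPower x ≠ 0) :
    |x / 4| ≤ M ∧ totalPower (intLabels (subtree false L)) (x / 4) = q := by
  have hc := hMC _ (L 0).2
  have hl : |x / 4| ≤ M := by
    rw [abs_le] at hx ⊢; constructor <;> linarith
  have hr : |(x + intLabels L 0) / 4| ≤ M := by
    rw [abs_le] at hx hc ⊢; unfold intLabels; constructor <;> linarith
  refine ⟨hl, le_antisymm ?_ (hq _ _ hl)⟩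
  have h1 := totalPower_eq (odd_intLabels hC L) x
  have h2 := mul_le_mul_of_nonneg_left (hq (subtree true L) _ hr)
    (maskPower_nonneg (x + intLabels L 0))
  rw [h] at h1
  rw [maskPower_add_odd x (odd_intLabels hC L 0)] at h1 h2
  have h3 := lt_of_le_of_ne (maskPower_nonneg x) h0.symm
  refine le_of_mul_le_mul_left ?_ h3
  change maskPower x * totalPower (subtree false (intLabels L)) (x / 4) ≤ _
  change _ ≤ _ * totalPower (subtree true (intLabels L)) _ at h2
  linarith

theorem totalPower_subtree_true (hC : ∀ c ∈ C, Odd c) (hMC : ∀ c ∈ C, |(c : ℝ)| ≤ M)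
    {L : ℕ → C} {x : ℝ} (hx : |x| ≤ M) (h : totalPower (intLabels L) x = q)
    (h0 : maskPower x = 0) :
    |(x + intLabels L 0) / 4| ≤ M ∧
      totalPower (intLabels (subtree true L)) ((x + intLabels L 0) / 4) = q := by
  have hc := hMC _ (L 0).2
  have hr : |(x + intLabels L 0) / 4| ≤ M := by
    rw [abs_le] at hx hc ⊢; unfold intLabels; constructor <;> linarith
  refine ⟨hr, ?_⟩
  have h1 := totalPower_eq (odd_intLabels hC L) x
  rw [h, maskPower_add_odd x (odd_intLabels hC L 0), h0, zero_mul, zero_add, sub_zero,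
    one_mul] at h1
  exact h1.symm

theorem exists_int_of_totalPower_eq (hC : ∀ c ∈ C, Odd c) (hMC : ∀ c ∈ C, |(c : ℝ)| ≤ M)
    (hq : ∀ (L : ℕ → C) (x : ℝ), |x| ≤ M → q ≤ totalPower (intLabels L) x) (hlt : q < 1)
    {L : ℕ → C} {x : ℝ} (hx : |x| ≤ M) (h : totalPower (intLabels L) x = q) :
    ∃ z : ℤ, z ≠ 0 ∧ x = z := by
  by_contra! hne
  have hiter : ∀ n : ℕ, ∃ L : ℕ → C, |x / 4 ^ n| ≤ M ∧
      totalPower (intLabels L) (x / 4 ^ n) = q := by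
    intro n
    induction n with
    | zero => exact ⟨L, by simpa using hx, by simpa using h⟩
    | succ n ih =>
      obtain ⟨L', hx', hL'⟩ := ih
      rw [pow_succ, ← div_div]
      refine ⟨subtree false L', totalPower_subtree_false hC hMC hq hx' hL' fun h0 => ?_⟩
      -- The left weight vanishes only at odd integers, and then x = 4^n a would be a nonzero
      -- integer.
      obtain ⟨a, ha, hxa⟩ := exists_odd_of_maskPower_eq_zero h0
      refine hne (4 ^ n * a) (mul_ne_zero (by positivity) ?_) ?_
      · rintro rfl; exact absurd ha (by decide)
      · rw [div_eq_iff (by positivity)] at hxa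
        rw [hxa]; push_cast; ring
  have hlim : Filter.Tendsto (fun n : ℕ => cantorPower (x / 4 ^ n)) Filter.atTop (nhds 1) := by
    rw [← cantorPower_zero]
    refine (continuous_cantorPower.tendsto 0).comp ?_
    exact tendsto_const_nhds.div_atTop (tendsto_pow_atTop_atTop_of_one_lt (by norm_num))
  refine absurd (le_of_tendsto' hlim fun n => ?_) (not_le.2 hlt)
  obtain ⟨L', -, hL'⟩ := hiter n
  rw [← hL']
  exact cantorPower_le_totalPower (odd_intLabels hC L') _

end Minimizers

theorem totalPower_eq_one {C : Finset ℤ} (hC : ∀ c ∈ C, Odd c) (hZ : ¬ HasInvariantSet C)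
    (L : ℕ → C) (ξ : ℝ) : totalPower (intLabels L) ξ = 1 := by
  obtain ⟨M, hMξ, hMC⟩ : ∃ M : ℝ, |ξ| ≤ M ∧ ∀ c ∈ C, |(c : ℝ)| ≤ M := by
    refine ⟨|ξ| + ∑ c ∈ C, |(c : ℝ)|,
      le_add_of_nonneg_right (Finset.sum_nonneg fun _ _ => abs_nonneg _), fun c hc => ?_⟩
    have := Finset.single_le_sum (f := fun c : ℤ => |(c : ℝ)|) (fun _ _ => abs_nonneg _) hc
    linarith [abs_nonneg ξ]
  obtain ⟨L₀, x₀, hx₀, hq⟩ := exists_forall_totalPower_le hC L ((abs_nonneg ξ).trans hMξ)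
  refine le_antisymm (ciSup_le fun n => levelPower_le_one (odd_intLabels hC L) n ξ)
    (le_trans ?_ (hq L ξ hMξ))
  obtain ⟨q, hq0⟩ : ∃ q, totalPower (intLabels L₀) x₀ = q := ⟨_, rfl⟩
  rw [hq0] at hq ⊢
  by_contra! hlt
  -- The integers at which some labelling attains the minimum.
  refine hZ ⟨{z | |(z : ℝ)| ≤ M ∧ ∃ L : ℕ → C, totalPower (intLabels L) z = q}, ?_, ?_, ?_⟩
  · obtain ⟨z, -, rfl⟩ := exists_int_of_totalPower_eq hC hMC hq hlt hx₀ hq0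
    exact ⟨z, hx₀, L₀, hq0⟩
  · rintro ⟨h1, L', h2⟩
    obtain ⟨z, hz, h⟩ := exists_int_of_totalPower_eq hC hMC hq hlt h1 h2
    exact hz (Int.cast_injective h.symm)
  · rintro z ⟨hz, L', hL'⟩
    by_cases h0 : maskPower z = 0
    · obtain ⟨h1, h2⟩ := totalPower_subtree_true hC hMC hz hL' h0
      obtain ⟨z', -, h3⟩ := exists_int_of_totalPower_eq hC hMC hq hlt h1 h2
      rw [h3] at h1 h2
      refine ⟨z', ⟨h1, _, h2⟩, Or.inr ⟨intLabels L' 0, (L' 0).2, ?_⟩⟩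
      have h4 : (4 * z' : ℝ) = z + intLabels L' 0 := by rw [← h3]; ring
      exact_mod_cast h4
    · obtain ⟨h1, h2⟩ := totalPower_subtree_false hC hMC hq hz hL' h0
      obtain ⟨z', -, h3⟩ := exists_int_of_totalPower_eq hC hMC hq hlt h1 h2
      rw [h3] at h1 h2
      refine ⟨z', ⟨h1, _, h2⟩, Or.inl ?_⟩
      have h4 : (4 * z' : ℝ) = z := by rw [← h3]; ring
      exact_mod_cast h4

theorem nonSpectral_eq_empty {C : Finset ℤ} (hC : ∀ c ∈ C, Odd c) (hZ : ¬ HasInvariantSet C) :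
    nonSpectral C = ∅ := by
  rw [Set.eq_empty_iff_forall_notMem]
  intro L hL
  exact hL (isSpectrum_of_totalPower_eq_one (fun i => hC _ (L i).2) (totalPower_eq_one hC hZ L))

theorem not_hasInvariantSet_one_seven : ¬ HasInvariantSet {1, 7} := by
  rintro ⟨Z, hne, h0, hZ⟩
  obtain ⟨z, hz, hmin⟩ : ∃ z ∈ Z, ∀ w ∈ Z, z.natAbs ≤ w.natAbs := by
    obtain ⟨z, hz, h⟩ := WellFounded.has_min (measure Int.natAbs).wf Z hne
    exact ⟨z, hz, fun w hw => not_lt.1 (h w hw)⟩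
  have hz0 : z ≠ 0 := fun h => h0 (h ▸ hz)
  have hsucc : ∀ z ∈ Z, ∃ z' ∈ Z, z' ≠ 0 ∧ (4 * z' = z ∨ 4 * z' = z + 1 ∨ 4 * z' = z + 7) := by
    intro z hz
    obtain ⟨z', hz', h⟩ := hZ z hz
    refine ⟨z', hz', fun h => h0 (h ▸ hz'), ?_⟩
    simpa using h
  obtain ⟨z', hz', hz'0, h⟩ := hsucc z hz
  have h1 := hmin z' hz'
  -- Minimality gives 3|z| ≤ 7, which leaves only z = 1 and z' = 2; but 2 has no successor.
  obtain ⟨z'', -, -, h'⟩ := hsucc z' hz'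
  omega

/-! ### Hausdorff dimension of sets of words -/

theorem wordDimH_mono {A : Type*} {r : ℝ} (h0 : 0 < r) (h1 : r < 1) {S T : Set (ℕ → A)}
    (h : S ⊆ T) : wordDimH r h0 h1 S ≤ wordDimH r h0 h1 T := by
  let := wordMetric A r h0 h1
  exact dimH_mono h

theorem wordDimH_finite {A : Type*} {r : ℝ} (h0 : 0 < r) (h1 : r < 1) {S : Set (ℕ → A)}
    (h : S.Finite) : wordDimH r h0 h1 S = 0 := by
  let := wordMetric A r h0 h1
  exact dimH_finite h

theorem wordMetric_dist_of_ne {A : Type*} {r : ℝ} (h0 : 0 < r) (h1 : r < 1) {x y : ℕ → A}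
    (h : x ≠ y) : (wordMetric A r h0 h1).dist x y = r ^ PiNat.firstDiff x y :=
  if_neg h

theorem wordMetric_dist_le {A : Type*} {r : ℝ} (h0 : 0 < r) (h1 : r < 1) {x y : ℕ → A} {n : ℕ}
    (h : ∀ i < n, x i = y i) : (wordMetric A r h0 h1).dist x y ≤ r ^ n := by
  rcases eq_or_ne x y with rfl | hxy
  · rw [(wordMetric A r h0 h1).dist_self]
    positivity
  · rw [wordMetric_dist_of_ne h0 h1 hxy]
    refine pow_le_pow_of_le_one h0.le h1.le (not_lt.1 fun hlt => ?_)
    exact PiNat.apply_firstDiff_ne hxy (h _ hlt)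

/-! ### The dimension of the full word space. -/

theorem dimH_univ_le_one_of_cover {X : Type*} [EMetricSpace X] {m : ℕ} (hm : 2 ≤ m)
    {ι : ℕ → Type*} [∀ n, Fintype (ι n)] (hcard : ∀ n, Fintype.card (ι n) = m ^ n)
    (t : ∀ n, ι n → Set X) (hdiam : ∀ n i, Metric.ediam (t n i) ≤ (m : ENNReal)⁻¹ ^ n)
    (hcover : ∀ n, Set.univ ⊆ ⋃ i, t n i) : dimH (Set.univ : Set X) ≤ 1 := by
  borelize X
  have h : Measure.hausdorffMeasure 1 (Set.univ : Set X) ≤ 1 := by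
    refine (Measure.hausdorffMeasure_le_liminf_sum 1 Set.univ (l := Filter.atTop)
      (fun n => (m : ENNReal)⁻¹ ^ n) ?_ t (Filter.Eventually.of_forall hdiam)
      (Filter.Eventually.of_forall hcover)).trans ?_
    · refine ENNReal.tendsto_pow_atTop_nhds_zero_of_lt_one ?_
      rw [ENNReal.inv_lt_one]
      exact_mod_cast (by omega : 1 < m)
    · refine Filter.liminf_le_of_le (by isBoundedDefault) fun b hb => ?_
      obtain ⟨n, hn⟩ := hb.exists
      refine hn.trans ?_
      calc ∑ i, Metric.ediam (t n i) ^ (1 : ℝ) ≤ ∑ i : ι n, (m : ENNReal)⁻¹ ^ n := by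
            refine Finset.sum_le_sum fun i _ => ?_
            rw [ENNReal.rpow_one]
            exact hdiam n i
        _ = (m : ENNReal) ^ n * (m : ENNReal)⁻¹ ^ n := by
            rw [Finset.sum_const, Finset.card_univ, hcard, nsmul_eq_mul]; push_cast; rfl
        _ = 1 := by
            rw [← mul_pow, ENNReal.mul_inv_cancel (by exact_mod_cast (by omega : m ≠ 0))
              (ENNReal.natCast_ne_top m), one_pow]
  have := dimH_le_of_hausdorffMeasure_ne_top (X := X) (d := 1) (s := Set.univ)
    (ne_top_of_le_ne_top ENNReal.one_ne_top (by exact_mod_cast h))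
  exact_mod_cast this

/-- Cylinders give the upper bound. For the lower bound, reading a word as base m digits is a
1-Lipschitz map onto [0, 1]. -/
theorem wordDimH_univ_eq_one {A : Type*} [Fintype A] (hA : 2 ≤ Fintype.card A) {r : ℝ}
    (h0 : 0 < r) (h1 : r < 1) (hr : r = 1 / (Fintype.card A : ℝ)) :
    wordDimH r h0 h1 (Set.univ : Set (ℕ → A)) = 1 := by
  classical
  let := wordMetric A r h0 h1
  change dimH (Set.univ : Set (ℕ → A)) = 1
  have hr' : ∀ n : ℕ, ENNReal.ofReal (r ^ n) = (Fintype.card A : ENNReal)⁻¹ ^ n := fun n => by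
    rw [ENNReal.ofReal_pow h0.le, hr, one_div, ENNReal.ofReal_inv_of_pos
      (by exact_mod_cast (by omega : 0 < Fintype.card A)), ENNReal.ofReal_natCast]
  apply le_antisymm
  · refine dimH_univ_le_one_of_cover hA (ι := fun n => Fin n → A) (fun n => by simp)
      (fun n w => {x : ℕ → A | ∀ i : Fin n, x i = w i}) (fun n w => ?_) (fun n x _ => ?_)
    · rw [← hr']
      refine Metric.ediam_le fun x hx y hy => ?_
      rw [edist_dist]
      refine ENNReal.ofReal_le_ofReal (wordMetric_dist_le h0 h1 fun i hi => ?_)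
      exact (hx ⟨i, hi⟩).trans (hy ⟨i, hi⟩).symm
    · exact Set.mem_iUnion.2 ⟨fun i => x i, fun i => rfl⟩
  · let e := Fintype.equivFin A
    let φ : (ℕ → A) → ℝ := fun x => Real.ofDigits fun i => e (x i)
    have hφ : LipschitzWith 1 φ := by
      refine LipschitzWith.of_dist_le_mul fun x y => ?_
      rcases eq_or_ne x y with rfl | hxy
      · simp
      rw [NNReal.coe_one, one_mul, Real.dist_eq]
      refine (Real.abs_ofDigits_sub_ofDigits_le (n := PiNat.firstDiff x y) fun i hi => ?_).trans
        (le_of_eq ?_)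
      · rw [PiNat.apply_eq_of_lt_firstDiff hi]
      · rw [← inv_pow, ← one_div, ← hr]
        exact (wordMetric_dist_of_ne h0 h1 hxy).symm
    have hsurj : Set.Icc (0 : ℝ) 1 ⊆ φ '' Set.univ := by
      intro y hy
      obtain ⟨d, -, hd⟩ := Real.ofDigits_SurjOn (by omega : 1 < Fintype.card A) hy
      exact ⟨fun i => e.symm (d i), trivial, by simpa [φ] using hd⟩
    calc (1 : ENNReal) = dimH (Set.Icc (0 : ℝ) 1) := by
          rw [Real.dimH_of_nonempty_interior (by simp [interior_Icc])]; simp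
      _ ≤ dimH (φ '' Set.univ) := dimH_mono hsurj
      _ ≤ dimH Set.univ := hφ.dimH_image_le _

/-! ### Words with letters prescribed at sparse positions. -/

open Classical in
theorem exists_mul_le_count_add {g : ℕ → ℕ} (hg : ∀ n, 2 ^ n ≤ g n + 1) {α : ℝ} (hα : α < 1) :
    ∃ c : ℕ, ∀ n : ℕ, α * n ≤ Nat.count (fun h => h ∉ Set.range g) n + c := by
  have hlim := tendsto_pow_const_div_const_pow_of_one_lt 1 (by norm_num : (1 : ℝ) < 2)
  obtain ⟨J, hJ⟩ := Filter.eventually_atTop.1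
    (hlim.eventually (gt_mem_nhds (by linarith : 0 < 1 - α)))
  refine ⟨J + 1, fun n => ?_⟩
  -- If g j < n, then 2^j ≤ n, so at most log₂ n + 1 positions below n are prescribed.
  have hcard : n ≤ Nat.count (fun h => h ∉ Set.range g) n + (Nat.log 2 n + 1) := by
    have hsub : (Finset.range n).filter (fun h => ¬ h ∉ Set.range g) ⊆
        (Finset.range (Nat.log 2 n + 1)).image g := by
      intro h hh
      obtain ⟨h1, h2⟩ := Finset.mem_filter.1 hh
      obtain ⟨j, rfl⟩ := not_not.1 h2
      have h3 := Finset.mem_range.1 h1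
      refine Finset.mem_image.2 ⟨j, Finset.mem_range.2 (Nat.lt_succ_of_le ?_), rfl⟩
      exact (Nat.le_log_iff_pow_le (by omega) (by omega)).2 ((hg j).trans h3)
    have h1 := (Finset.card_le_card hsub).trans Finset.card_image_le
    have h2 := Finset.card_filter_add_card_filter_not (s := Finset.range n)
      (fun h => h ∉ Set.range g)
    rw [Nat.count_eq_card_filter_range]
    simp only [Finset.card_range] at h1 h2
    omega
  have hcard' : (n : ℝ) ≤ Nat.count (fun h => h ∉ Set.range g) n + (Nat.log 2 n + 1) := by
    exact_mod_cast hcard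
  rcases Nat.eq_zero_or_pos n with rfl | hn
  · simp; positivity
  have hlog : (Nat.log 2 n : ℝ) ≤ (1 - α) * n + J := by
    rcases le_or_gt J (Nat.log 2 n) with h | h
    · have h1 := hJ _ h
      rw [pow_one, div_lt_iff₀ (by positivity)] at h1
      have h2 : ((2 : ℝ) ^ Nat.log 2 n) ≤ n := by
        exact_mod_cast Nat.pow_log_le_self 2 (by omega)
      have h3 := mul_le_mul_of_nonneg_left h2 (by linarith : 0 ≤ 1 - α)
      have : (0 : ℝ) ≤ J := by positivity
      linarith
    · have h1 : (Nat.log 2 n : ℝ) ≤ J := by exact_mod_cast h.le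
      have h2 := mul_nonneg (by linarith : 0 ≤ 1 - α) (Nat.cast_nonneg (α := ℝ) n)
      linarith
  push_cast
  linarith

theorem infinite_compl_range_of_two_pow_le {g : ℕ → ℕ} (hg : ∀ n, 2 ^ n ≤ g n + 1) :
    (Set.ofPred fun h => h ∉ Set.range g).Infinite := by
  classical
  intro hfin
  obtain ⟨c, hc⟩ := exists_mul_le_count_add hg (by norm_num : (1 / 2 : ℝ) < 1)
  have hle : ∀ n, Nat.count (fun h => h ∉ Set.range g) n ≤ hfin.toFinset.card := fun n => by
    rw [Nat.count_eq_card_filter_range]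
    exact Finset.card_le_card fun h hh => hfin.mem_toFinset.2 (Finset.mem_filter.1 hh).2
  have h1 := hc (2 * (hfin.toFinset.card + c) + 2)
  have h2 : (Nat.count (fun h => h ∉ Set.range g) (2 * (hfin.toFinset.card + c) + 2) : ℝ) ≤
      hfin.toFinset.card := by exact_mod_cast hle _
  push_cast at h1
  linarith

/-- Prescribing the letters at positions which grow exponentially does not change the Hausdorff
dimension. -/
theorem wordDimH_univ_le_of_sparse {A : Type*} {r : ℝ} (h0 : 0 < r) (h1 : r < 1) {g : ℕ → ℕ}
    (hinj : Function.Injective g) (hg : ∀ n, 2 ^ n ≤ g n + 1) (a : ℕ → A) :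
    wordDimH r h0 h1 (Set.univ : Set (ℕ → A)) ≤
      wordDimH r h0 h1 {x : ℕ → A | ∀ n, x (g n) = a n} := by
  classical
  let := wordMetric A r h0 h1
  change dimH (Set.univ : Set (ℕ → A)) ≤ dimH {x : ℕ → A | ∀ n, x (g n) = a n}
  set P : ℕ → Prop := fun h => h ∉ Set.range g
  have hinf : (Set.ofPred P).Infinite := infinite_compl_range_of_two_pow_le hg
  -- Deleting the prescribed letters maps the restricted set onto the full space. This map is Hölder
  -- for every exponent b < 1, and b → 1 gives the claim.
  let f : (ℕ → A) → ℕ → A := fun x i => x (Nat.nth P i)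
  have hsurj : f '' {x : ℕ → A | ∀ n, x (g n) = a n} = Set.univ := by
    refine Set.eq_univ_of_forall fun y =>
      ⟨fun h => if hh : h ∈ Set.range g then a hh.choose else y (Nat.count P h), fun n => ?_, ?_⟩
    · have hh : g n ∈ Set.range g := ⟨n, rfl⟩
      simp only [hh, dif_pos]
      rw [hinj hh.choose_spec]
    · funext i
      have hh : Nat.nth P i ∉ Set.range g := Nat.nth_mem_of_infinite hinf i
      simp only [f, hh, dif_neg, not_false_eq_true, Nat.count_nth_of_infinite hinf]
  rw [← hsurj]
  refine ENNReal.le_of_forall_lt_one_mul_le fun b hb => ?_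
  lift b to NNReal using hb.ne_top
  have hb1 : b < 1 := by exact_mod_cast hb
  rcases eq_or_ne b 0 with rfl | hb0
  · simp
  obtain ⟨c, hc⟩ := exists_mul_le_count_add hg (by exact_mod_cast hb1 : (b : ℝ) < 1)
  -- A common prefix of length n keeps at least b n - c free letters, so the distance r^n becomes at
  -- most r^(b n - c).
  have hholder : HolderWith (Real.toNNReal (r ^ (-(c : ℝ)))) b f := by
    intro x y
    rcases eq_or_ne x y with rfl | hxy
    · simp
    have hd : dist (f x) (f y) ≤ r ^ Nat.count P (PiNat.firstDiff x y) :=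
      wordMetric_dist_le h0 h1 fun i hi =>
        show x (Nat.nth P i) = y (Nat.nth P i) from
          PiNat.apply_eq_of_lt_firstDiff (Nat.nth_lt_of_lt_count hi)
    have hxyd : dist x y = r ^ PiNat.firstDiff x y := wordMetric_dist_of_ne h0 h1 hxy
    rw [edist_dist, edist_dist, ENNReal.ofReal_rpow_of_nonneg dist_nonneg b.coe_nonneg,
      show ((Real.toNNReal (r ^ (-(c : ℝ))) : NNReal) : ENNReal) = ENNReal.ofReal _ from rfl,
      ← ENNReal.ofReal_mul (by positivity)]
    refine ENNReal.ofReal_le_ofReal (hd.trans ?_)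
    rw [hxyd, ← Real.rpow_natCast, ← Real.rpow_natCast, ← Real.rpow_mul h0.le,
      ← Real.rpow_add h0]
    refine Real.rpow_le_rpow_of_exponent_ge h0 h1.le ?_
    have := hc (PiNat.firstDiff x y)
    linarith
  have h := hholder.dimH_image_le (pos_iff_ne_zero.2 hb0)
    {x : ℕ → A | ∀ n, x (g n) = a n}
  rw [mul_comm]
  exact (ENNReal.le_div_iff_mul_le (Or.inl (by exact_mod_cast hb0))
    (Or.inl ENNReal.coe_ne_top)).1 h

/-! ### Labellings that follow an invariant set -/

/-- The nodes of a path in the tree, given by its turns. -/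
def pathNode : (ℕ → Bool) → ℕ → ℕ
  | _, 0 => 0
  | b, n + 1 => childIndex (b 0) (pathNode (fun i => b (i + 1)) n)

theorem log_pathNode (b : ℕ → Bool) (n : ℕ) : Nat.log 2 (pathNode b n + 1) = n := by
  induction n generalizing b with
  | zero => simp [pathNode]
  | succ n ih => rw [pathNode, log_childIndex, ih]

theorem injective_pathNode (b : ℕ → Bool) : Function.Injective (pathNode b) := fun m n h => by
  rw [← log_pathNode b m, h, log_pathNode]

theorem two_pow_le_pathNode (b : ℕ → Bool) (n : ℕ) : 2 ^ n ≤ pathNode b n + 1 := by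
  conv_lhs => rw [← log_pathNode b n]
  exact Nat.pow_log_le_self 2 (by omega)

/-- The orbit divides by 4 until it meets an odd number, which happens since absolute values drop;
so z 0 is 4^j times an odd integer. -/
theorem cantorPower_orbit_eq_zero {z : ℕ → ℤ} (hz : ∀ n, z n ≠ 0)
    (heven : ∀ n, ¬ Odd (z n) → 4 * z (n + 1) = z n) : cantorPower (z 0) = 0 := by
  by_cases h : Odd (z 0)
  · exact cantorPower_odd h
  · have h1 : 4 * z 1 = z 0 := heven 0 h
    have hlt : (z 1).natAbs < (z 0).natAbs := by have := hz 0; omega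
    have h2 := cantorPower_orbit_eq_zero (z := fun n => z (n + 1)) (fun n => hz _)
      fun n => heven _
    rw [← h1]
    push_cast
    exact cantorPower_four_mul h2
termination_by (z 0).natAbs

/-- While the path of y agrees with that of the orbit, a common factor 4 splits off. Where it
leaves, exactly one of z n and the label taken is odd, so the remaining argument is an odd integer.
If it never leaves, `cantorPower_orbit_eq_zero` applies at the end. -/
theorem cantorPower_orbit_add_eq_zero {n : ℕ} {z : ℕ → ℤ} {L : ℕ → ℤ} (hL : ∀ i, Odd (L i))
    (hz : ∀ n, z n ≠ 0) (heven : ∀ n, ¬ Odd (z n) → 4 * z (n + 1) = z n)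
    (hodd : ∀ n, Odd (z n) →
      4 * z (n + 1) = z n + L (pathNode (fun i => decide (Odd (z i))) n))
    {y : ℤ} (hy : y ∈ treeSums n L) : cantorPower ((z 0 : ℝ) + y) = 0 := by
  induction n generalizing z L y with
  | zero =>
    rw [treeSums, Finset.mem_singleton] at hy
    rw [hy, Int.cast_zero, add_zero]
    exact cantorPower_orbit_eq_zero hz heven
  | succ n ih =>
    have hrec : ∀ u ∈ treeSums n (subtree (decide (Odd (z 0))) L),
        cantorPower (4 * ((z 1 : ℝ) + u)) = 0 := fun u hu =>
      cantorPower_four_mul (ih (z := fun n => z (n + 1)) (fun i => hL _) (fun n => hz _)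
        (fun n => heven _) (fun n => hodd (n + 1)) hu)
    rw [← Int.cast_add]
    rcases mem_treeSums_succ.1 hy with ⟨u, hu, rfl⟩ | ⟨u, hu, rfl⟩
    · by_cases h : Odd (z 0)
      · exact cantorPower_odd (odd_add_four_mul h u)
      · rw [show z 0 + 4 * u = 4 * (z 1 + u) by rw [← heven 0 h]; ring]
        push_cast
        exact hrec u (by rwa [decide_eq_false h])
    · by_cases h : Odd (z 0)
      · have h2 : 4 * z 1 = z 0 + L 0 := hodd 0 h
        rw [show z 0 + (L 0 + 4 * u) = 4 * (z 1 + u) by linarith]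
        push_cast
        exact hrec u (by rwa [decide_eq_true h])
      · refine cantorPower_odd ?_
        rw [← add_assoc]
        exact odd_add_four_mul ((Int.not_odd_iff_even.1 h).add_odd (hL 0)) u

theorem exists_sparse_subset_nonSpectral {C : Finset ℤ} (hC : ∀ c ∈ C, Odd c) (hne : C.Nonempty)
    (hZ : HasInvariantSet C) : ∃ (g : ℕ → ℕ) (a : ℕ → C), Function.Injective g ∧
      (∀ n, 2 ^ n ≤ g n + 1) ∧ {L : ℕ → C | ∀ n, L (g n) = a n} ⊆ nonSpectral C := by
  obtain ⟨Z, ⟨z₀, hz₀⟩, h0, hZ⟩ := hZ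
  have hstep : ∀ z : Z, ∃ (z' : Z) (c : C), (¬ Odd (z : ℤ) → 4 * (z' : ℤ) = z) ∧
      (Odd (z : ℤ) → 4 * (z' : ℤ) = z + c) := by
    rintro ⟨z, hz⟩
    obtain ⟨z', hz', h | ⟨c, hc, h⟩⟩ := hZ z hz
    -- An even z moves to z/4 without using a label, so any element of C serves.
    · refine ⟨⟨z', hz'⟩, ⟨_, hne.choose_spec⟩, fun _ => h, fun hodd => ?_⟩
      rw [Int.odd_iff] at hodd
      simp only at hodd
      omega
    · refine ⟨⟨z', hz'⟩, ⟨c, hc⟩, fun hodd => ?_, fun _ => h⟩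
      have := hC c hc
      rw [Int.odd_iff] at this hodd
      simp only at hodd
      omega
  choose s a heven hodd using hstep
  let z : ℕ → Z := fun n => s^[n] ⟨z₀, hz₀⟩
  have hs : ∀ n, z (n + 1) = s (z n) := fun n => Function.iterate_succ_apply' s n _
  refine ⟨pathNode fun i => decide (Odd (z i : ℤ)), fun n => a (z n), injective_pathNode _,
    two_pow_le_pathNode _, fun L hL => ?_⟩
  refine not_isSpectrum_of_cantorPower_eq_zero (ξ := (z 0 : ℤ)) fun n y hy =>
    cantorPower_orbit_add_eq_zero (z := fun n => (z n : ℤ)) (L := intLabels L)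
      (odd_intLabels hC L) (fun n h => h0 (h ▸ (z n).2)) (fun n h => ?_) (fun n h => ?_) hy
  · rw [hs]; exact heven _ h
  · rw [hs, hodd _ h, intLabels, hL n]

end MiddleFourth

theorem theorem3p3 :
    (∀ C : Finset ℤ, C.image (fun c : ℤ => c % 4) = {1, 3} →
      MiddleFourth.nonSpectral C = ∅ ∨
        ((MiddleFourth.nonSpectral C).Infinite ∧
          ∀ (r : ℝ) (h0 : 0 < r) (h1 : r < 1),
            MiddleFourth.wordDimH r h0 h1 (MiddleFourth.nonSpectral C) =
                MiddleFourth.wordDimH r h0 h1 (Set.univ : Set (ℕ → C)) ∧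
              (r = 1 / (C.card : ℝ) →
                MiddleFourth.wordDimH r h0 h1 (MiddleFourth.nonSpectral C) = 1))) ∧
      MiddleFourth.nonSpectral {1, 7} = ∅ := by
  refine ⟨fun C hC => ?_, MiddleFourth.nonSpectral_eq_empty (fun c hc => ?_)
    MiddleFourth.not_hasInvariantSet_one_seven⟩
  · have hodd : ∀ c ∈ C, Odd c := fun c hc => by
      have h : c % 4 ∈ C.image (fun c : ℤ => c % 4) := Finset.mem_image_of_mem _ hc
      rw [hC, Finset.mem_insert, Finset.mem_singleton] at h
      rw [Int.odd_iff]
      omega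
    have hcard : 2 ≤ C.card := by
      have h : (C.image fun c : ℤ => c % 4).card = 2 := by rw [hC]; rfl
      exact h ▸ Finset.card_image_le
    by_cases hZ : MiddleFourth.HasInvariantSet C
    · obtain ⟨g, a, hinj, hg, hsub⟩ := MiddleFourth.exists_sparse_subset_nonSpectral hodd
        (Finset.card_pos.1 (by omega)) hZ
      have hdim : ∀ (r : ℝ) (h0 : 0 < r) (h1 : r < 1),
          MiddleFourth.wordDimH r h0 h1 (MiddleFourth.nonSpectral C) =
            MiddleFourth.wordDimH r h0 h1 (Set.univ : Set (ℕ → C)) := fun r h0 h1 =>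
        le_antisymm (MiddleFourth.wordDimH_mono h0 h1 (Set.subset_univ _))
          ((MiddleFourth.wordDimH_univ_le_of_sparse h0 h1 hinj hg a).trans
            (MiddleFourth.wordDimH_mono h0 h1 hsub))
      have hone : ∀ (r : ℝ) (h0 : 0 < r) (h1 : r < 1), r = 1 / (C.card : ℝ) →
          MiddleFourth.wordDimH r h0 h1 (MiddleFourth.nonSpectral C) = 1 := fun r h0 h1 hr => by
        rw [hdim]
        exact MiddleFourth.wordDimH_univ_eq_one (by simpa using hcard) h0 h1 (by simpa using hr)
      -- Infinite because its dimension for r = 1/m is 1, whereas finite sets have dimension 0.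
      refine Or.inr ⟨fun hfin => ?_, fun r h0 h1 => ⟨hdim r h0 h1, hone r h0 h1⟩⟩
      have hc : (1 : ℝ) < C.card := by exact_mod_cast hcard
      have h0 : (0 : ℝ) < 1 / C.card := by positivity
      have h1 : 1 / (C.card : ℝ) < 1 := by rwa [div_lt_one (by linarith)]
      have h2 := hone _ h0 h1 rfl
      rw [MiddleFourth.wordDimH_finite h0 h1 hfin] at h2
      exact zero_ne_one h2
    · exact Or.inl (MiddleFourth.nonSpectral_eq_empty hodd hZ)
  · rw [Finset.mem_insert, Finset.mem_singleton] at hc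
    rcases hc with rfl | rfl <;> decide
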